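/- Let $q,p\in\mathbb N$ with $q\ge p$, and let $f:\mathbb R^n\to\mathbb R$. Assume that there are a compact topological space $S$ and $C^{q+1}$ functions $f_s:\mathbb R^n\to\mathbb R$, $s\in S$, such that $f(x)=\max_{s\in S}f_s(x)$ for all $x$ and such that $f_s(x)$ and all its partial derivatives in $x$ up to order $q+1$ depend continuously on $(s,x)\in S\times\mathbb R^n$. Let $x^0\in\mathbb R^n$ be such that the sublevel set $\{x: f(x)\le f(x^0)\}$ is bounded. Write $\bar B_\Delta(x)=\{y:\|y-x\|\le\Delta\}$ for the closed Euclidean ball. For each $x\in\mathbb R^n$ fix an index $s(x)\in S$ with $f_{s(x)}(x)=f(x)$. For a finite nonempty set $W\subseteq\mathbb R^n$ let $$\mathcal T^{q,W}(z)=\max_{y\in W}\sum_{m=0}^q\frac1{m!}D^m f_{s(y)}(y)(z-y)^m ,$$ and for $x\in\mathbb R^n$, $\Delta>0$ let $\bar z^{q,W}(x,\Delta)$ be a chosen minimizer of $\mathcal T^{q,W}$ over $\bar B_\Delta(x)$. Let $\sigma\in(0,1)$, $c>0$, and let $(\Delta_j)_{j\ge1}$, $(\tau_j)_{j\ge1}$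 be sequences of positive reals converging to $0$. Consider the following method, started with $x^{1,0}=x^0$. For $j=1,2,\dots$ and, within this loop, for $i=0,1,\dots$: 1. Starting with $W=\{x^{j,i}\}$, replace $W$ by $W\cup\{\bar z^{q,W}(x^{j,i},\Delta_j)\}$ as long as $f(z)-\mathcal T^{q,W}(z)>\min(\Delta_j^{q+\sigma},c)$ for $z=\bar z^{q,W}(x^{j,i},\Delta_j)$; let $W_{j,i}$ be the final set $W$ and $\bar z^{j,i}=\bar z^{q,W_{j,i}}(x^{j,i},\Delta_j)$. 2. If $(f(x^{j,i})-f(\bar z^{j,i}))/\Delta_j^p<\tau_j$, set $x^j=x^{j+1,0}=x^{j,i}$ and continue with the next $j$; otherwise set $x^{j,i+1}=\bar z^{j,i}$ and continue with the next $i$. For $x\in\mathbb R^n$ and $\Delta>0$ let $\Lambda^p(x,\Delta)=\bigl(f(x)-\min_{z\in\bar B_\Delta(x)}f(z)\bigr)/\Delta^p$. A point $x^*\in\mathbb R^n$ has property (P) for $p$ if there are an open neighborhood $U$ of $x^*$ and a constant $C>0$ such that $\Lambda^p(x,\Delta)\ge C$ for all $x\in U$ and $\Delta>0$ with $x^*\notin\bar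 B_\Delta(x)$. Then all loops in step 1 and all loops over $i$ terminate, so the method generates a well-defined infinite sequence $(x^j)_{j\ge1}$; and if $x^*$ is an accumulation point of $(x^j)_j$ that has property (P) for $p$, then $x^*\in\bar B_{\Delta_j}(x^j)$ for infinitely many $j\in\mathbb N$. -/

import Mathlib

open Set Filter Topology

noncomputable section

namespace TrustRegionBundle

/-- `ℝⁿ` with the Euclidean norm. -/
abbrev E (n : ℕ) := EuclideanSpace ℝ (Fin n)

/-- `f` is the pointwise maximum of the `C^{q+1}` functions `F s`, `s ∈ S`, with `S` a compact
topological space, and each `F s` and its derivatives up to order `q + 1` depend continuously on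
`(s, x)`. -/
structure IsMaxRepresentation {n : ℕ} {S : Type*} [TopologicalSpace S]
    (q : ℕ) (f : E n → ℝ) (F : S → E n → ℝ) : Prop where
  compactSpace : CompactSpace S
  contDiff : ∀ s, ContDiff ℝ ((q + 1 : ℕ) : WithTop ℕ∞) (F s)
  continuous_deriv : ∀ m : ℕ, m ≤ q + 1 →
    Continuous fun a : S × E n => iteratedFDeriv ℝ m (F a.1) a.2
  isMax : ∀ x, IsGreatest (range fun s => F s x) (f x)

/-- The oracle's index `sel x` belongs to the active set `A(x) = {s | f_s(x) = f(x)}`. -/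
def IsOracle {n : ℕ} {S : Type*} (f : E n → ℝ) (F : S → E n → ℝ) (sel : E n → S) : Prop :=
  ∀ x, sel x ∈ {s : S | F s x = f x}

/-- The Taylor polynomial `T^q g(z, y) = ∑_{m ≤ q} (1 / m!) D^m g(y)(z - y)^m`. -/
def taylor {n : ℕ} (q : ℕ) (g : E n → ℝ) (z y : E n) : ℝ :=
  ∑ m ∈ Finset.range (q + 1),
    (1 / (m.factorial : ℝ)) * iteratedFDeriv ℝ m g y (fun _ => z - y)

/-- The `q`-order cutting-plane model `𝒯^{q,W}(z) = max_{y ∈ W} T^q f_{s(y)}(z, y)`; it is only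
used for finite nonempty `W`, where the supremum is a maximum. -/
def model {n : ℕ} {S : Type*} (q : ℕ) (F : S → E n → ℝ) (sel : E n → S)
    (W : Set (E n)) (z : E n) : ℝ :=
  sSup ((fun y => taylor q (F (sel y)) z y) '' W)

/-- `zbar W x Δ` is, for every finite nonempty `W`, every `x` and every `Δ > 0`, a solution of the
trust-region subproblem `min {𝒯^{q,W}(z) | z ∈ closedBall x Δ}`. -/
def IsSubproblemSolver {n : ℕ} {S : Type*} (q : ℕ) (F : S → E n → ℝ) (sel : E n → S)
    (zbar : Set (E n) → E n → ℝ → E n) : Prop :=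
  ∀ (W : Set (E n)) (x : E n) (Δ : ℝ), W.Finite → W.Nonempty → 0 < Δ →
    zbar W x Δ ∈ Metric.closedBall x Δ ∧
      IsMinOn (model q F sel W) (Metric.closedBall x Δ) (zbar W x Δ)

/-- Everything an execution of the method has access to: the objective, the selection functions
through the oracle, the subproblem solver, and the scalar parameters. -/
structure Setup (n : ℕ) (S : Type*) where
  f : E n → ℝ
  F : S → E n → ℝ
  sel : E n → S
  zbar : Set (E n) → E n → ℝ → E n
  p : ℕ
  q : ℕ
  σ : ℝ
  c : ℝ

/-- The stopping criterion of the bundle computation for the current bundle `W`. -/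
def BundleStop {n : ℕ} {S : Type*} (P : Setup n S) (x : E n) (Δ : ℝ) (W : Set (E n)) : Prop :=
  P.f (P.zbar W x Δ) - model P.q P.F P.sel W (P.zbar W x Δ)
    ≤ min (Δ ^ ((P.q : ℝ) + P.σ)) P.c

/-- `ComputesBundle P x Δ W W'`: the bundle computation at `x` with radius `Δ`, started with the
bundle `W`, terminates after finitely many iterations with the bundle `W'`. -/
inductive ComputesBundle {n : ℕ} {S : Type*} (P : Setup n S) (x : E n) (Δ : ℝ) :
    Set (E n) → Set (E n) → Prop
  | finish (W : Set (E n)) : BundleStop P x Δ W → ComputesBundle P x Δ W W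
  | extend (W W' : Set (E n)) : ¬ BundleStop P x Δ W →
      ComputesBundle P x Δ (W ∪ {P.zbar W x Δ}) W' → ComputesBundle P x Δ W W'

/-- `InnerLoop P Δ τ x x'`: the inner loop of the method with radius `Δ` and tolerance `τ`,
started at `x`, is left after finitely many iterations (each of which terminates) with the final
iterate `x'`. -/
inductive InnerLoop {n : ℕ} {S : Type*} (P : Setup n S) (Δ τ : ℝ) : E n → E n → Prop
  | leave (x : E n) (W : Set (E n)) : ComputesBundle P x Δ {x} W →
      (P.f x - P.f (P.zbar W x Δ)) / Δ ^ P.p < τ → InnerLoop P Δ τ x x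
  | next (x x' : E n) (W : Set (E n)) : ComputesBundle P x Δ {x} W →
      ¬ (P.f x - P.f (P.zbar W x Δ)) / Δ ^ P.p < τ →
      InnerLoop P Δ τ (P.zbar W x Δ) x' → InnerLoop P Δ τ x x'

/-- `x` is the sequence of outer iterates `x⁰, x¹, x², …` generated by the method from the initial
point `x0` with radii `Δ 1, Δ 2, …` and tolerances `τ 1, τ 2, …` (`Δ 0` and `τ 0` are not used):
the `j`-th inner loop (`j ≥ 1`) starts at `x (j - 1)` and ends at `x j`. -/
def IsGenerated {n : ℕ} {S : Type*} (P : Setup n S) (Δ τ : ℕ → ℝ) (x0 : E n)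
    (x : ℕ → E n) : Prop :=
  x 0 = x0 ∧ ∀ j : ℕ, InnerLoop P (Δ (j + 1)) (τ (j + 1)) (x j) (x (j + 1))

/-- `z*(x, Δ)`: a minimizer of `f` over `closedBall x Δ` (one exists for continuous `f`). -/
def zStar {n : ℕ} (f : E n → ℝ) (x : E n) (Δ : ℝ) : E n :=
  Classical.epsilon fun z =>
    z ∈ Metric.closedBall x Δ ∧ IsMinOn f (Metric.closedBall x Δ) z

/-- `Λ^p(x, Δ) = (f(x) - f(z*(x, Δ))) / Δ^p`. -/
def Lam {n : ℕ} (f : E n → ℝ) (p : ℕ) (x : E n) (Δ : ℝ) : ℝ :=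
  (f x - f (zStar f x Δ)) / Δ ^ p

/-- Property (P) for `f`, `p` and `xs`. -/
def PropertyP {n : ℕ} (f : E n → ℝ) (p : ℕ) (xs : E n) : Prop :=
  ∃ U : Set (E n), IsOpen U ∧ xs ∈ U ∧ ∃ C : ℝ, 0 < C ∧
    ∀ x ∈ U, ∀ Δ : ℝ, 0 < Δ → xs ∉ Metric.closedBall x Δ → C ≤ Lam f p x Δ

end TrustRegionBundle

end

open Set Filter Topology

noncomputable section

namespace TrustRegionBundle

variable {n : ℕ} {S : Type*}

/-! ### Continuity, Taylor estimates and minimizers -/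

section Analysis

variable [TopologicalSpace S] {q : ℕ} {f : E n → ℝ} {F : S → E n → ℝ}

/-! Bundle termination is a compactness argument: infinitely many trial points would have nearby
members `z k`, `z l` with `k < l`. The later model contains the Taylor polynomial based at `z k`,
which at `z l` is close to `f (z k)`, hence to `f (z l)`, so the gap could not stay above a fixed
threshold (`exists_computesBundle`). Each continued inner step lowers `f` by at least `τ * Δ ^ p`,
and `f` is bounded below (`exists_innerLoop`). On leaving the inner loop, the model is accurate at
the trial point by the stopping test, and exceeds `f` by `O(Δ ^ (q + 1))` at most in the trust
region. So the trial point is nearly optimal, and `p ≤ q` makes `Λ^p` tend to `0` along iterates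
near `xs` (`InnerLoop.Lam_le`). Property (P) forbids this while `xs` lies outside the trust regions.
-/

/-- The maximum function of a compact `C^{q+1}` family is continuous. -/
theorem IsMaxRepresentation.continuous (hF : IsMaxRepresentation q f F) : Continuous f := by
  have := hF.compactSpace
  have h0 : Continuous fun a : S × E n => F a.1 a.2 := by
    have h := (hF.continuous_deriv 0 (Nat.zero_le _)).eval_const (fun _ => (0 : E n))
    simpa only [iteratedFDeriv_zero_apply] using h
  have h1 := (isCompact_univ (X := S)).continuous_sSup (f := fun x s => F s x)
    (h0.comp continuous_swap)
  refine h1.congr fun x => ?_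
  rw [image_univ]
  exact (hF.isMax x).csSup_eq

/-- The derivatives of the family up to order `q + 1` are uniformly bounded on closed balls. -/
theorem IsMaxRepresentation.exists_iteratedFDeriv_bound (hF : IsMaxRepresentation q f F)
    (x : E n) (R : ℝ) : ∃ M : ℝ, 0 ≤ M ∧ ∀ m ≤ q + 1, ∀ s, ∀ y ∈ Metric.closedBall x R,
      ‖iteratedFDeriv ℝ m (F s) y‖ ≤ M := by
  have := hF.compactSpace
  have h : ∀ m : ℕ, ∃ C : ℝ, m ≤ q + 1 → ∀ s, ∀ y ∈ Metric.closedBall x R,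
      ‖iteratedFDeriv ℝ m (F s) y‖ ≤ C := by
    intro m
    by_cases hm : m ≤ q + 1
    · obtain ⟨C, hC⟩ := (isCompact_univ.prod (isCompact_closedBall x R)).exists_bound_of_continuousOn
        (hF.continuous_deriv m hm).continuousOn
      exact ⟨C, fun _ s y hy => hC (s, y) ⟨mem_univ s, hy⟩⟩
    · exact ⟨0, fun h => absurd h hm⟩
  choose C hC using h
  refine ⟨∑ m ∈ Finset.range (q + 2), |C m|, Finset.sum_nonneg fun _ _ => abs_nonneg _,
    fun m hm s y hy => (hC m hm s y hy).trans ((le_abs_self _).trans ?_)⟩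
  exact Finset.single_le_sum (f := fun m => |C m|) (fun _ _ => abs_nonneg _)
    (Finset.mem_range.2 (by omega))

/-- The Taylor polynomial stays close to the value at its base point. -/
theorem abs_taylor_sub_le {g : E n → ℝ} {y : E n} {M : ℝ}
    (hM : ∀ m ≤ q + 1, ‖iteratedFDeriv ℝ m g y‖ ≤ M) (z : E n) :
    |taylor q g z y - g y| ≤ ∑ m ∈ Finset.range q, M * ‖z - y‖ ^ (m + 1) := by
  -- The order-zero term cancels `g y`, leaving only positive powers of `‖z - y‖`.
  rw [taylor, Finset.sum_range_succ']
  simp only [Nat.factorial_zero, Nat.cast_one, div_one, one_mul, iteratedFDeriv_zero_apply,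
    add_sub_cancel_right]
  refine (Finset.abs_sum_le_sum_abs _ _).trans (Finset.sum_le_sum fun m hm => ?_)
  have hm' := Finset.mem_range.1 hm
  have h1 := (iteratedFDeriv ℝ (m + 1) g y).le_opNorm (fun _ => z - y)
  rw [Finset.prod_const, Finset.card_univ, Fintype.card_fin, Real.norm_eq_abs] at h1
  have h2 : |iteratedFDeriv ℝ (m + 1) g y (fun _ => z - y)| ≤ M * ‖z - y‖ ^ (m + 1) :=
    h1.trans (by gcongr; exact hM _ (by omega))
  rw [abs_mul]
  have h3 : |1 / ((m + 1).factorial : ℝ)| ≤ 1 := by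
    rw [abs_of_nonneg (by positivity)]
    exact (div_le_one (by positivity)).2 (by exact_mod_cast Nat.factorial_pos _)
  exact (mul_le_of_le_one_left (abs_nonneg _) h3).trans h2

/-- Taylor's remainder estimate on a convex set. -/
theorem abs_sub_taylor_le {g : E n → ℝ} (hg : ContDiff ℝ ((q + 1 : ℕ) : WithTop ℕ∞) g)
    {K : Set (E n)} (hK : Convex ℝ K) {M : ℝ}
    (hM : ∀ y ∈ K, ‖iteratedFDeriv ℝ (q + 1) g y‖ ≤ M) {y z : E n} (hy : y ∈ K) (hz : z ∈ K) :
    |g z - taylor q g z y| ≤ M * ‖z - y‖ ^ (q + 1) := by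
  have hM0 : 0 ≤ M := (norm_nonneg _).trans (hM y hy)
  -- Integral remainder; both `(1 - t) ^ q` and `1 / q!` are simply bounded by `1`.
  have h := map_add_eq_sum_add_integral_iteratedFDeriv (f := g) (x := y) (y := z - y) (n := q)
    fun t _ => by exact_mod_cast hg.contDiffAt
  rw [add_sub_cancel] at h
  have ht : taylor q g z y = ∑ k ∈ Finset.range (q + 1),
      (k.factorial : ℝ)⁻¹ • (iteratedFDeriv ℝ k g y (fun _ => z - y)) := by
    simp only [taylor, one_div, smul_eq_mul]
  rw [← ht] at h
  have hI : ‖∫ t in (0 : ℝ)..1, (1 - t) ^ q •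
      iteratedFDeriv ℝ (q + 1) g (y + t • (z - y)) (fun _ => z - y)‖
      ≤ M * ‖z - y‖ ^ (q + 1) * |(1 : ℝ) - 0| := by
    refine intervalIntegral.norm_integral_le_of_norm_le_const fun t ht => ?_
    rw [uIoc_of_le zero_le_one] at ht
    have h1 := (iteratedFDeriv ℝ (q + 1) g (y + t • (z - y))).le_opNorm (fun _ => z - y)
    rw [Finset.prod_const, Finset.card_univ, Fintype.card_fin] at h1
    have hmem : y + t • (z - y) ∈ K := hK.add_smul_sub_mem hy hz ⟨ht.1.le, ht.2⟩
    have h2 : ‖(1 - t) ^ q‖ ≤ 1 := by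
      rw [norm_pow, Real.norm_eq_abs, abs_of_nonneg (by linarith [ht.2])]
      exact pow_le_one₀ (by linarith [ht.2]) (by linarith [ht.1])
    rw [norm_smul]
    refine (mul_le_of_le_one_left (norm_nonneg _) h2).trans (h1.trans ?_)
    gcongr
    exact hM _ hmem
  rw [sub_zero, abs_one, mul_one] at hI
  have hq : ‖(q.factorial : ℝ)⁻¹‖ ≤ 1 := by
    rw [norm_inv, Real.norm_natCast]
    exact inv_le_one_of_one_le₀ (by exact_mod_cast Nat.factorial_pos q)
  rw [sub_eq_of_eq_add' h, ← Real.norm_eq_abs, norm_smul]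
  exact (mul_le_of_le_one_left (norm_nonneg _) hq).trans hI

/-- A continuous function with a bounded nonempty sublevel set is bounded below. -/
theorem exists_forall_le_of_isBounded_sublevel (hf : Continuous f) {x0 : E n}
    (hbdd : Bornology.IsBounded {x | f x ≤ f x0}) : ∃ b, ∀ x, b ≤ f x := by
  have hc : IsCompact {x | f x ≤ f x0} :=
    Metric.isCompact_of_isClosed_isBounded (isClosed_le hf continuous_const) hbdd
  obtain ⟨a, ha, hmin⟩ := hc.exists_isMinOn ⟨x0, le_refl (f x0)⟩ hf.continuousOn
  refine ⟨f a, fun x => ?_⟩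
  rcases le_total (f x) (f x0) with h | h
  · exact hmin h
  · exact le_trans ha h

theorem zStar_spec (hf : Continuous f) (x : E n) {Δ : ℝ} (hΔ : 0 ≤ Δ) :
    zStar f x Δ ∈ Metric.closedBall x Δ ∧ IsMinOn f (Metric.closedBall x Δ) (zStar f x Δ) := by
  obtain ⟨z, hz, hmin⟩ := (isCompact_closedBall x Δ).exists_isMinOn
    ⟨x, Metric.mem_closedBall_self hΔ⟩ hf.continuousOn
  exact Classical.epsilon_spec (p := fun z => z ∈ Metric.closedBall x Δ ∧
    IsMinOn f (Metric.closedBall x Δ) z) ⟨z, hz, hmin⟩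

end Analysis

/-! ### The cutting-plane model as a finite maximum -/

section Model

variable {q : ℕ} {F : S → E n → ℝ} {sel : E n → S} {W : Set (E n)}

theorem taylor_le_model (hW : W.Finite) {y : E n} (hy : y ∈ W) (z : E n) :
    taylor q (F (sel y)) z y ≤ model q F sel W z :=
  le_csSup (hW.image _).bddAbove (mem_image_of_mem _ hy)

theorem model_le (hW : W.Nonempty) {z : E n} {a : ℝ}
    (h : ∀ y ∈ W, taylor q (F (sel y)) z y ≤ a) : model q F sel W z ≤ a :=
  csSup_le (hW.image _) (forall_mem_image.2 h)

end Model

/-! ### Termination and accuracy of the bundle computation -/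

section Bundle

variable {P : Setup n S} {x : E n} {Δ : ℝ}

theorem ComputesBundle.unique {W W₁ W₂ : Set (E n)} (h₁ : ComputesBundle P x Δ W W₁)
    (h₂ : ComputesBundle P x Δ W W₂) : W₁ = W₂ := by
  induction h₁ with
  | finish W h =>
    cases h₂ with
    | finish _ _ => rfl
    | extend _ _ h' _ => exact absurd h h'
  | extend W W' h _ ih =>
    cases h₂ with
    | finish _ h' => exact absurd h' h
    | extend _ _ _ h' => exact ih h'

theorem ComputesBundle.bundleStop {W W' : Set (E n)} (h : ComputesBundle P x Δ W W') :
    BundleStop P x Δ W' := by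
  induction h with
  | finish W h => exact h
  | extend W W' _ _ ih => exact ih

/-- The computed bundle is a finite nonempty subset of the trust region. -/
theorem ComputesBundle.finite_nonempty_subset (hzbar : IsSubproblemSolver P.q P.F P.sel P.zbar)
    (hΔ : 0 < Δ) {W W' : Set (E n)} (h : ComputesBundle P x Δ W W') (hfin : W.Finite)
    (hne : W.Nonempty) (hsub : W ⊆ Metric.closedBall x Δ) :
    W'.Finite ∧ W'.Nonempty ∧ W' ⊆ Metric.closedBall x Δ := by
  induction h with
  | finish W h => exact ⟨hfin, hne, hsub⟩
  | extend W W' _ _ ih =>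
    exact ih (hfin.union (finite_singleton _)) hne.inl
      (union_subset hsub (singleton_subset_iff.2 (hzbar W x Δ hfin hne hΔ).1))

/-- The successive bundles of the bundle computation, ignoring the stopping criterion. -/
def bundleIter (P : Setup n S) (x : E n) (Δ : ℝ) : ℕ → Set (E n)
  | 0 => {x}
  | k + 1 => bundleIter P x Δ k ∪ {P.zbar (bundleIter P x Δ k) x Δ}

theorem bundleIter_mono (P : Setup n S) (x : E n) (Δ : ℝ) : Monotone (bundleIter P x Δ) :=
  monotone_nat_of_le_succ fun _ => subset_union_left

theorem bundleIter_finite (P : Setup n S) (x : E n) (Δ : ℝ) (k : ℕ) :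
    (bundleIter P x Δ k).Finite := by
  induction k with
  | zero => exact finite_singleton x
  | succ k ih => exact ih.union (finite_singleton _)

theorem bundleIter_nonempty (P : Setup n S) (x : E n) (Δ : ℝ) (k : ℕ) :
    (bundleIter P x Δ k).Nonempty :=
  (singleton_nonempty x).mono (bundleIter_mono P x Δ (Nat.zero_le k))

/-- Pulls termination back from stage `k` to the start; if an earlier stage already passes the test,
it finishes there. -/
theorem exists_computesBundle_of_bundleIter {k : ℕ}
    (h : ∃ W, ComputesBundle P x Δ (bundleIter P x Δ k) W) :
    ∃ W, ComputesBundle P x Δ {x} W := by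
  induction k with
  | zero => exact h
  | succ k ih =>
    apply ih
    by_cases hs : BundleStop P x Δ (bundleIter P x Δ k)
    · exact ⟨_, .finish _ hs⟩
    · obtain ⟨W, hW⟩ := h
      exact ⟨W, .extend _ _ hs hW⟩

/-- The bundle computation terminates. -/
theorem exists_computesBundle [TopologicalSpace S] (hF : IsMaxRepresentation P.q P.f P.F)
    (hsel : IsOracle P.f P.F P.sel) (hzbar : IsSubproblemSolver P.q P.F P.sel P.zbar)
    (hc : 0 < P.c) (hΔ : 0 < Δ) : ∃ W, ComputesBundle P x Δ {x} W := by
  by_contra hno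
  have hns : ∀ k, ¬ BundleStop P x Δ (bundleIter P x Δ k) := fun k hk =>
    hno (exists_computesBundle_of_bundleIter ⟨_, .finish _ hk⟩)
  set ε : ℝ := min (Δ ^ ((P.q : ℝ) + P.σ)) P.c with hε
  have hε0 : 0 < ε := lt_min (Real.rpow_pos_of_pos hΔ _) hc
  set z : ℕ → E n := fun k => P.zbar (bundleIter P x Δ k) x Δ with hz
  have hzB : ∀ k, z k ∈ Metric.closedBall x Δ := fun k =>
    (hzbar _ x Δ (bundleIter_finite P x Δ k) (bundleIter_nonempty P x Δ k) hΔ).1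
  have hgap : ∀ k l, k < l → ε < P.f (z l) - taylor P.q (P.F (P.sel (z k))) (z l) (z k) := by
    intro k l hkl
    have hmem : z k ∈ bundleIter P x Δ l :=
      bundleIter_mono P x Δ (Nat.succ_le_of_lt hkl) (Or.inr rfl)
    have h1 := taylor_le_model (q := P.q) (F := P.F) (sel := P.sel)
      (bundleIter_finite P x Δ l) hmem (z l)
    have h2 := not_le.1 (hns l)
    linarith
  obtain ⟨M, -, hM⟩ := hF.exists_iteratedFDeriv_bound x Δ
  obtain ⟨a, -, φ, hφ, hlim⟩ := (isCompact_closedBall x Δ).tendsto_subseq hzB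
  have hlim' : Tendsto (fun k => z (φ (k + 1))) atTop (𝓝 a) :=
    hlim.comp (tendsto_add_atTop_nat 1)
  -- Upper bounds for the gaps along the subsequence vanish, contradicting `hgap`.
  have hcont := hF.continuous
  have hsum : Tendsto (fun k => P.f (z (φ (k + 1))) - P.f (z (φ k)) +
      ∑ m ∈ Finset.range P.q, M * ‖z (φ (k + 1)) - z (φ k)‖ ^ (m + 1)) atTop (𝓝 0) := by
    have h1 := ((hcont.tendsto a).comp hlim').sub ((hcont.tendsto a).comp hlim)
    have h2 := (hlim'.sub hlim).norm
    have h3 := tendsto_finsetSum (Finset.range P.q)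
      fun m _ => (h2.pow (m + 1)).const_mul M
    simpa using h1.add h3
  obtain ⟨k, hk⟩ := (hsum.eventually_lt_const hε0).exists
  have h1 := hgap _ _ (hφ (Nat.lt_succ_self k))
  have h2 := abs_le.1 (abs_taylor_sub_le (q := P.q) (g := P.F (P.sel (z (φ k))))
    (fun m hm => hM m hm (P.sel (z (φ k))) _ (hzB (φ k))) (z (φ (k + 1))))
  have h3 : P.F (P.sel (z (φ k))) (z (φ k)) = P.f (z (φ k)) := hsel _
  rw [h3] at h2
  have h4 := h2.1
  simp only [Nat.succ_eq_add_one] at h1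
  linarith

/-- The value of `f` at the computed trial point is almost optimal in the trust region. -/
theorem ComputesBundle.sub_zStar_le [TopologicalSpace S]
    (hF : IsMaxRepresentation P.q P.f P.F) (hzbar : IsSubproblemSolver P.q P.F P.sel P.zbar)
    (hΔ : 0 < Δ) {M : ℝ}
    (hM : ∀ s, ∀ y ∈ Metric.closedBall x Δ, ‖iteratedFDeriv ℝ (P.q + 1) (P.F s) y‖ ≤ M)
    {W : Set (E n)} (hW : ComputesBundle P x Δ {x} W) :
    P.f (P.zbar W x Δ) - P.f (zStar P.f x Δ) ≤
      Δ ^ ((P.q : ℝ) + P.σ) + M * (2 * Δ) ^ (P.q + 1) := by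
  obtain ⟨hfin, hne, hsub⟩ := hW.finite_nonempty_subset hzbar hΔ (finite_singleton x)
    (singleton_nonempty x) (singleton_subset_iff.2 (Metric.mem_closedBall_self hΔ.le))
  have hz := (zStar_spec hF.continuous x hΔ.le).1
  have h1 : P.f (P.zbar W x Δ) - model P.q P.F P.sel W (P.zbar W x Δ) ≤ Δ ^ ((P.q : ℝ) + P.σ) :=
    le_trans hW.bundleStop (min_le_left _ _)
  have h2 : model P.q P.F P.sel W (P.zbar W x Δ) ≤ model P.q P.F P.sel W (zStar P.f x Δ) :=
    (hzbar W x Δ hfin hne hΔ).2 hz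
  have h3 : model P.q P.F P.sel W (zStar P.f x Δ) ≤
      P.f (zStar P.f x Δ) + M * (2 * Δ) ^ (P.q + 1) := by
    refine model_le hne fun y hy => ?_
    have hM0 : 0 ≤ M := (norm_nonneg _).trans (hM (P.sel y) y (hsub hy))
    have h4 := abs_le.1 (abs_sub_taylor_le (hF.contDiff (P.sel y)) (convex_closedBall x Δ)
      (hM (P.sel y)) (hsub hy) hz)
    -- Each `F s` lies below `f`, so only the Taylor error can lift the model above `f`.
    have h5 : P.F (P.sel y) (zStar P.f x Δ) ≤ P.f (zStar P.f x Δ) :=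
      (hF.isMax _).2 (mem_range_self (P.sel y))
    have h6 : ‖zStar P.f x Δ - y‖ ≤ 2 * Δ := by
      have := dist_triangle_right (zStar P.f x Δ) y x
      rw [← dist_eq_norm]
      linarith [Metric.mem_closedBall.1 hz, Metric.mem_closedBall.1 (hsub hy)]
    have h7 : M * ‖zStar P.f x Δ - y‖ ^ (P.q + 1) ≤ M * (2 * Δ) ^ (P.q + 1) := by gcongr
    linarith [h4.1]
  linarith

end Bundle

/-! ### Inner and outer loops, and the bound on `Λ^p` -/

section Loops

variable {P : Setup n S} {Δ τ : ℝ}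

theorem InnerLoop.unique {x x₁ x₂ : E n} (h₁ : InnerLoop P Δ τ x x₁)
    (h₂ : InnerLoop P Δ τ x x₂) : x₁ = x₂ := by
  induction h₁ with
  | leave x W hW h =>
    cases h₂ with
    | leave _ _ _ _ => rfl
    | next _ _ W' hW' h' _ => exact absurd (hW.unique hW' ▸ h) h'
  | next x x' W hW h _ ih =>
    cases h₂ with
    | leave _ W' hW' h' => exact absurd (hW.unique hW' ▸ h') h
    | next _ _ W' hW' _ h' =>
      obtain rfl := hW.unique hW'
      exact ih h'

/-- The inner loop is left at a point where the trial step does not decrease `f` sufficiently. -/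
theorem InnerLoop.exists_computesBundle_lt {x x' : E n} (h : InnerLoop P Δ τ x x') :
    ∃ W, ComputesBundle P x' Δ {x'} W ∧ (P.f x' - P.f (P.zbar W x' Δ)) / Δ ^ P.p < τ := by
  induction h with
  | leave x W hW h => exact ⟨W, hW, h⟩
  | next x x' W hW h _ ih => exact ih

/-- The inner loop terminates. -/
theorem exists_innerLoop {b : ℝ} (hb : ∀ x, b ≤ P.f x)
    (hW : ∀ x, ∃ W, ComputesBundle P x Δ {x} W) (hΔ : 0 < Δ) (hτ : 0 < τ) (x : E n) :
    ∃ x', InnerLoop P Δ τ x x' := by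
  have hδ : 0 < τ * Δ ^ P.p := by positivity
  -- `N` bounds the number of decreases by `τ * Δ ^ p` still possible above `b`.
  have key : ∀ (N : ℕ) (x : E n), P.f x - b < N * (τ * Δ ^ P.p) → ∃ x', InnerLoop P Δ τ x x' := by
    intro N
    induction N with
    | zero =>
      intro x hx
      have := hb x
      rw [Nat.cast_zero, zero_mul] at hx
      linarith
    | succ N ih =>
      intro x hx
      obtain ⟨W, hWx⟩ := hW x
      by_cases h : (P.f x - P.f (P.zbar W x Δ)) / Δ ^ P.p < τ
      · exact ⟨x, .leave x W hWx h⟩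
      · have h' := (le_div_iff₀ (by positivity)).1 (not_lt.1 h)
        obtain ⟨x', hx'⟩ := ih (P.zbar W x Δ) (by push_cast at hx; linarith)
        exact ⟨x', .next x x' W hWx h hx'⟩
  obtain ⟨N, hN⟩ := exists_nat_gt ((P.f x - b) / (τ * Δ ^ P.p))
  exact key N x ((div_lt_iff₀ hδ).1 hN)

theorem existsUnique_isGenerated {Δ τ : ℕ → ℝ} (x0 : E n)
    (h : ∀ j x, ∃ x', InnerLoop P (Δ (j + 1)) (τ (j + 1)) x x') :
    ∃! x : ℕ → E n, IsGenerated P Δ τ x0 x := by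
  choose g hg using h
  refine ⟨fun j => Nat.rec x0 g j, ⟨rfl, fun j => hg j _⟩, fun y hy => funext fun j => ?_⟩
  induction j with
  | zero => exact hy.1
  | succ j ih =>
    have hj := hy.2 j
    rw [ih] at hj
    exact hj.unique (hg j _)

/-- If `xs` has property (P), then the trust regions contain `xs` for infinitely many outer
iterates as soon as `Λ^p` is asymptotically small near `xs`. -/
theorem PropertyP.infinite_mem_closedBall {f : E n → ℝ} {p : ℕ} {xs : E n}
    (hP : PropertyP f p xs) {x : ℕ → E n} (hx : MapClusterPt xs atTop x) {Δ : ℕ → ℝ}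
    (hΔ : ∀ j, 1 ≤ j → 0 < Δ j) {ε : ℕ → ℝ} (hε : Tendsto ε atTop (𝓝 0))
    (hLam : ∀ᶠ j in atTop, x j ∈ Metric.ball xs 1 → Lam f p (x j) (Δ j) ≤ ε j) :
    {j : ℕ | 1 ≤ j ∧ xs ∈ Metric.closedBall (x j) (Δ j)}.Infinite := by
  obtain ⟨U, hU, hxU, C, hC, hUC⟩ := hP
  rw [← Nat.frequently_atTop_iff_infinite]
  -- The unit ball keeps the iterates where one derivative bound serves them all.
  have hfreq := hx.frequently (inter_mem (hU.mem_nhds hxU) (Metric.ball_mem_nhds xs one_pos))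
  refine (hfreq.and_eventually ((hLam.and (hε.eventually_lt_const hC)).and
    (eventually_ge_atTop 1))).mono ?_
  rintro j ⟨⟨hjU, hjB⟩, ⟨hjL, hjε⟩, hj1⟩
  refine ⟨hj1, by_contra fun hmem => ?_⟩
  exact absurd ((hUC _ hjU _ (hΔ j hj1) hmem).trans (hjL hjB)) (not_le.2 hjε)

/-- Where the inner loop is left, `Λ^p` is bounded by a quantity vanishing with `Δ` and `τ`. -/
theorem InnerLoop.Lam_le [TopologicalSpace S] (hF : IsMaxRepresentation P.q P.f P.F)
    (hzbar : IsSubproblemSolver P.q P.F P.sel P.zbar) (hpq : P.p ≤ P.q)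
    (hΔ : 0 < Δ) (hΔ1 : Δ ≤ 1) {x x' : E n} (h : InnerLoop P Δ τ x x') {M : ℝ} (hM0 : 0 ≤ M)
    (hM : ∀ s, ∀ y ∈ Metric.closedBall x' Δ, ‖iteratedFDeriv ℝ (P.q + 1) (P.F s) y‖ ≤ M) :
    Lam P.f P.p x' Δ ≤ τ + (Δ ^ P.σ + M * 2 ^ (P.q + 1) * Δ) := by
  obtain ⟨W, hW, hlt⟩ := h.exists_computesBundle_lt
  have hpos : 0 < Δ ^ P.p := by positivity
  rw [div_lt_iff₀ hpos] at hlt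
  have h1 := hW.sub_zStar_le hF hzbar hΔ hM
  have hpow : Δ ^ P.q ≤ Δ ^ P.p := pow_le_pow_of_le_one hΔ.le hΔ1 hpq
  have h2 : Δ ^ ((P.q : ℝ) + P.σ) ≤ Δ ^ P.σ * Δ ^ P.p := by
    rw [Real.rpow_add hΔ, Real.rpow_natCast, mul_comm]
    gcongr
  have h3 : M * (2 * Δ) ^ (P.q + 1) ≤ M * 2 ^ (P.q + 1) * Δ * Δ ^ P.p := by
    calc M * (2 * Δ) ^ (P.q + 1) = M * 2 ^ (P.q + 1) * Δ * Δ ^ P.q := by ring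
      _ ≤ _ := by gcongr
  rw [Lam, div_le_iff₀ hpos]
  linarith

end Loops

end TrustRegionBundle

end

theorem mainTheorem2 {n : ℕ} {S : Type*} [TopologicalSpace S]
    (f : TrustRegionBundle.E n → ℝ) (F : S → TrustRegionBundle.E n → ℝ)
    (p q : ℕ) (hpq : p ≤ q)
    (hF : TrustRegionBundle.IsMaxRepresentation q f F)
    (sel : TrustRegionBundle.E n → S) (hsel : TrustRegionBundle.IsOracle f F sel)
    (zbar : Set (TrustRegionBundle.E n) → TrustRegionBundle.E n → ℝ → TrustRegionBundle.E n)
    (hzbar : TrustRegionBundle.IsSubproblemSolver q F sel zbar)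
    (σ c : ℝ) (hσ0 : 0 < σ) (hσ1 : σ < 1) (hc : 0 < c)
    (Δ τ : ℕ → ℝ) (hΔpos : ∀ j, 1 ≤ j → 0 < Δ j) (hτpos : ∀ j, 1 ≤ j → 0 < τ j)
    (hΔ : Filter.Tendsto Δ Filter.atTop (nhds 0))
    (hτ : Filter.Tendsto τ Filter.atTop (nhds 0))
    (x0 : TrustRegionBundle.E n) (hbdd : Bornology.IsBounded {x | f x ≤ f x0}) :
    (∃! x : ℕ → TrustRegionBundle.E n,
      TrustRegionBundle.IsGenerated ⟨f, F, sel, zbar, p, q, σ, c⟩ Δ τ x0 x) ∧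
    ∀ x : ℕ → TrustRegionBundle.E n,
      TrustRegionBundle.IsGenerated ⟨f, F, sel, zbar, p, q, σ, c⟩ Δ τ x0 x →
      ∀ xs : TrustRegionBundle.E n, MapClusterPt xs Filter.atTop x →
        TrustRegionBundle.PropertyP f p xs →
        {j : ℕ | 1 ≤ j ∧ xs ∈ Metric.closedBall (x j) (Δ j)}.Infinite := by
  set P : TrustRegionBundle.Setup n S := ⟨f, F, sel, zbar, p, q, σ, c⟩
  obtain ⟨b, hb⟩ :=
    TrustRegionBundle.exists_forall_le_of_isBounded_sublevel hF.continuous hbdd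
  constructor
  · refine TrustRegionBundle.existsUnique_isGenerated x0 fun j x => ?_
    have hΔj := hΔpos (j + 1) (by omega)
    exact TrustRegionBundle.exists_innerLoop (P := P) hb
      (fun y => TrustRegionBundle.exists_computesBundle (P := P) hF hsel hzbar hc hΔj)
      hΔj (hτpos (j + 1) (by omega)) x
  · intro x hx xs hxs hP
    -- Radius `2`: iterates within `1` of `xs`, plus trust-region radii below `1`.
    obtain ⟨M, hM0, hM⟩ := hF.exists_iteratedFDeriv_bound xs 2
    refine hP.infinite_mem_closedBall hxs hΔpos
      (ε := fun j => τ j + (Δ j ^ σ + M * 2 ^ (q + 1) * Δ j)) ?_ ?_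
    · have h1 := hΔ.rpow_const (p := σ) (Or.inr hσ0.le)
      -- Positivity of `σ` is what makes `Δ j ^ σ` vanish.
      rw [Real.zero_rpow hσ0.ne'] at h1
      simpa using hτ.add (h1.add (hΔ.const_mul (M * 2 ^ (q + 1))))
    · filter_upwards [hΔ.eventually_lt_const one_pos, Filter.eventually_ge_atTop 1]
        with j hj1 hj hjB
      obtain ⟨i, rfl⟩ := Nat.exists_eq_add_of_le' hj
      refine (hx.2 i).Lam_le (P := P) hF hzbar hpq (hΔpos _ hj) hj1.le hM0 fun s y hy =>
        hM _ le_rfl s y ?_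
      have h1 := dist_triangle y (x (i + 1)) xs
      rw [Metric.mem_closedBall] at hy ⊢
      rw [Metric.mem_ball] at hjB
      linarith
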